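/- Let $G$ be a finite connected non-bipartite symmetric directed graph (multi-arcs and self-loops allowed; every arc $e=(u,v)$ has a corresponding opposite arc $(v,u)$, a loop being its own opposite) with $m$ arcs, and let a cyclic order of the outgoing arcs be fixed at each vertex. A state of the rotor-router (RR) dynamics consists of a pointer to one outgoing arc and a number of tokens at each vertex. In every synchronous step each vertex sends out all its tokens one after another, each along the current pointer arc, advancing the pointer to the next arc in the cyclic order after each token; the tokens then arrive at the heads of the arcs. Let $k$ be the total number of tokens, let $x(t)$ be the state at time $t$, started from an arbitrary state $x(0)$, and let $L_{x(t)}(e)$ be the number of tokens sent along the arc $e$ in the step that starts in $x(t)$. A state is recurrent if the dynamics started in it returns to it after some positive number of steps. There are absolute constants $C>0$ and $c\in\mathbb{N}$ such that for all such $G$, cyclic orders, $k$ and $x(0)$, all arcs $e$, all integers $T\ge 1$, and all $t_0\ge 0$ such that $x(t_0)$ is recurrent, $$\left|\frac1T\sum_{t=t_0}^{t_0+T-1}L_{x(t)}(e)-\frac km\right|\le C\,(1+\log m)^c\cdot\frac{\gcd(k,m)}{T}.$$ In particular, for all constants $C_0>0$, $c_0\in\mathbb{N}$ there are constants $C>0$,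 $c\in\mathbb{N}$, depending only on $C_0$ and $c_0$, such that whenever moreover $\gcd(k,m)\le C_0(1+\log m)^{c_0}$, the left-hand side is at most $C(1+\log m)^c/T$. -/

import Mathlib

universe u v

/-- A symmetric directed graph with vertex type `V` and arc type `E`. Multi-arcs and self-loops are
allowed. Every arc `e` has an opposite arc `opp e`, and a loop is its own opposite. -/
structure SymDigraph (V : Type u) (E : Type v) where
  pred : E → V
  succ : E → V
  opp : E → E
  opp_opp : ∀ e, opp (opp e) = e
  pred_opp : ∀ e, pred (opp e) = succ e
  succ_opp : ∀ e, succ (opp e) = pred e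
  opp_loop : ∀ e, pred e = succ e → opp e = e

namespace SymDigraph

variable {V : Type u} {E : Type v}

/-- Any vertex is reachable from any other one by a directed path. -/
def Connected (G : SymDigraph V E) : Prop :=
  ∀ a b : V, Relation.ReflTransGen (fun x y => ∃ e, G.pred e = x ∧ G.succ e = y) a b

/-- The vertices can be coloured with two colours so that every arc joins different colours. -/
def Bipartite (G : SymDigraph V E) : Prop :=
  ∃ col : V → Bool, ∀ e, col (G.pred e) ≠ col (G.succ e)

end SymDigraph

/-- A cyclic ordering of the outgoing arcs at each vertex, given by the successor map `next`, which
permutes the arcs leaving each vertex in a single cycle. -/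
structure PortOrder {V : Type u} {E : Type v} (G : SymDigraph V E) where
  next : Equiv.Perm E
  isCycleOn : ∀ a : V, next.IsCycleOn {e | G.pred e = a}

/-- A state of the rotor-router: a port pointer (an outgoing arc) and a number of tokens
at each vertex. -/
@[ext]
structure RRState {V : Type u} {E : Type v} (G : SymDigraph V E) where
  pointer : V → E
  pred_pointer : ∀ a, G.pred (pointer a) = a
  tokens : V → ℕ

namespace PortOrder

variable {V : Type u} {E : Type v} {G : SymDigraph V E}

theorem pred_next_pow (ρ : PortOrder G) (i : ℕ) (e : E) :
    G.pred ((ρ.next ^ i) e) = G.pred e := by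
  induction i with
  | zero => simp
  | succ i ih =>
    rw [pow_succ', Equiv.Perm.mul_apply]
    have h := (ρ.isCycleOn (G.pred e)).1.mapsTo (show (ρ.next ^ i) e ∈ _ from ih)
    exact h

/-- The number of tokens sent out along the arc `e` in the step that starts in the state `x`:
the tokens at the vertex `pred e`, numbered from `0`, are sent one after another, the `i`-th one
along the `i`-th successor of the pointer. -/
def load [DecidableEq E] (ρ : PortOrder G) (x : RRState G) (e : E) : ℕ :=
  ((Finset.range (x.tokens (G.pred e))).filter
    (fun i => (ρ.next ^ i) (x.pointer (G.pred e)) = e)).card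

/-- One synchronous step of the dynamics: every vertex sends out all its tokens, advancing its
pointer once per token, and every token arrives at the head of the arc along which it was sent. -/
def step [DecidableEq V] [Fintype E] [DecidableEq E] (ρ : PortOrder G) (x : RRState G) :
    RRState G where
  pointer a := (ρ.next ^ (x.tokens a)) (x.pointer a)
  pred_pointer a := by rw [pred_next_pow, x.pred_pointer]
  tokens a := ∑ e ∈ Finset.univ.filter (fun e => G.succ e = a), ρ.load x e

/-- The state at time `t` of the dynamics initialized to the state `x₀`. -/
def stateAt [DecidableEq V] [Fintype E] [DecidableEq E] (ρ : PortOrder G) (x₀ : RRState G)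
    (t : ℕ) : RRState G :=
  ρ.step^[t] x₀

/-- A state is recurrent if the dynamics started in it returns to it. -/
def Recurrent [DecidableEq V] [Fintype E] [DecidableEq E] (ρ : PortOrder G) (x : RRState G) :
    Prop :=
  ∃ p : ℕ, 0 < p ∧ ρ.step^[p] x = x

/-- The average number of tokens sent along the arc `e` per step, in the window formed by the `T`
steps `t₀, …, t₀ + T - 1` of the dynamics initialized to `x₀`. -/
noncomputable def avgLoad [DecidableEq V] [Fintype E] [DecidableEq E] (ρ : PortOrder G)
    (x₀ : RRState G) (t₀ T : ℕ) (e : E) : ℝ :=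
  (∑ t ∈ Finset.Ico t₀ (t₀ + T), (ρ.load (ρ.stateAt x₀ t) e : ℝ)) / (T : ℝ)

end PortOrder

/-- The total number of tokens in a state. -/
def RRState.numTokens {V : Type u} {E : Type v} [Fintype V] {G : SymDigraph V E}
    (x : RRState G) : ℕ :=
  ∑ a, x.tokens a

/-!
In a recurrent state the tokens move along a permutation `π` of the arcs
(`PortOrder.exists_perm_load`). The reason is that the round-robin rule makes the numbers of tokens
on the arcs leaving a vertex, over any time window, equal up to one, so the sum of the squares of
the window loads cannot increase, and it is constant along a periodic orbit. Hence the loads of the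
arcs entering a vertex are balanced as well, and a balanced family of sequences is determined by
its totals, up to the order of its members.

The rest of the argument is about such a circulation (`ArcFlow`) of `k` tokens on `m` arcs. Over a
full period all arcs carry the same load. Therefore all orbits of `π` have at least `m / g` arcs,
where `g = gcd k m`, so there are at most `g` of them, and every arc `e` sees the same tokens as a
fixed arc `e₀`, with some time shift `x` (a position of `e`), up to `g` tokens per window
(`ArcFlow.exists_close`). For two positions `x`, `x'` of arcs with a common tail, shifting the time
by `x - x'` changes the window loads of `e₀` by at most `2 * g + 1`. It remains to write every time
shift, modulo the length `n` of the orbit of `e₀`, as a sum of polylogarithmically many differences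
of this kind, for then the window load of `e₀` differs from its average over all shifts by a
polylogarithmic multiple of `g`.

This is done with characters of `ZMod n`. A character `ψ` that is close to `1` on all those
differences is almost a function of the vertices, and the same holds for `ψ ^ 2`, which in addition
changes only by a small angle `τ` along an arc. The sum over all arcs of the change of that angle is
`0`, because an arc and its opposite contribute opposite amounts, and `m * τ`, because the orbits of
`π` cover all arcs. So `τ = 0`, and `ψ` is trivial, as the alternating character would give a
`2`-colouring (`SymDigraph.char_eq_zero_of_close_on_positions`). Finally, if no nontrivial
character of a finite abelian group `A` is close to `1` on a set `D`, a maximal dissociated subset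
of `D` has at most `log₂ |A|` elements and already has this property, with a logarithmic loss, and
Fourier inversion shows that all elements of `A` are sums of polylogarithmically many of its
elements (`exists_sum_eq_of_detecting`).
-/

/-! ### Generating a finite abelian group by few elements of a set no character is trivial on -/

theorem AddDissociated.card_le_log {A : Type*} [AddCommGroup A] [Fintype A]
    {T : Finset A} (hT : AddDissociated (T : Set A)) :
    T.card ≤ Nat.log 2 (Fintype.card A) := by
  classical
  refine Nat.le_log_of_pow_le (by norm_num) ?_
  rw [← Finset.card_powerset, ← Finset.card_univ]
  refine Finset.card_le_card_of_injOn (fun t => ∑ x ∈ t, x) (fun _ _ => Finset.mem_univ _) ?_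
  intro t ht u hu htu
  exact hT (by simpa using ht) (by simpa using hu) htu

theorem norm_zpow_sub_one_le {z : ℂ} {n : ℤ} (hz : ‖z‖ = 1) (hn : n = -1 ∨ n = 0 ∨ n = 1) :
    ‖z ^ n - 1‖ ≤ ‖z - 1‖ := by
  rcases hn with rfl | rfl | rfl
  · have h0 : z ≠ 0 := by rintro rfl; simp at hz
    have : z ^ (-1 : ℤ) - 1 = z⁻¹ * (1 - z) := by
      rw [zpow_neg_one]; field_simp
    rw [this, norm_mul, norm_inv, hz, norm_sub_rev]; simp
  · simp
  · simp

theorem AddChar.norm_map_sum_sub_one_le {A ι : Type*} [AddCommGroup A] [Finite A]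
    (ψ : AddChar A ℂ) (s : Finset ι) (f : ι → A) :
    ‖ψ (∑ i ∈ s, f i) - 1‖ ≤ ∑ i ∈ s, ‖ψ (f i) - 1‖ := by
  classical
  induction s using Finset.induction_on with
  | empty => simp
  | insert i s hi ih =>
    rw [Finset.sum_insert hi, Finset.sum_insert hi, AddChar.map_add_eq_mul]
    have : ψ (f i) * ψ (∑ j ∈ s, f j) - 1
        = ψ (f i) * (ψ (∑ j ∈ s, f j) - 1) + (ψ (f i) - 1) := by ring
    rw [this]
    refine (norm_add_le _ _).trans ?_
    rw [norm_mul, AddChar.norm_apply, one_mul]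
    linarith

/-- If every nontrivial character is at distance at least `1 / 4` from `1` somewhere on `D`, then
a subset of `D` of logarithmic size already detects all nontrivial characters, with a logarithmic
loss. The subset is a maximal dissociated one: all elements of `D` are combinations of its elements
with coefficients in `{-1, 0, 1}`. -/
theorem exists_small_subset_detecting {A : Type*} [AddCommGroup A] [Fintype A] (D : Finset A)
    (hD : ∀ ψ : AddChar A ℂ, (∀ d ∈ D, ‖ψ d - 1‖ < 1 / 4) → ψ = 0) :
    ∃ T ⊆ D, T.card ≤ Nat.log 2 (Fintype.card A) ∧
      ∀ ψ : AddChar A ℂ, ψ ≠ 0 → ∃ t ∈ T,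
        1 / (4 * ((Nat.log 2 (Fintype.card A) : ℝ) + 1)) ≤ ‖ψ t - 1‖ := by
  classical
  obtain ⟨T, hTD, hTc, hDT⟩ := Finset.exists_subset_addSpan_card_le_of_forall_addDissociated
    (s := D) (d := Nat.log 2 (Fintype.card A)) (fun s' _ h => h.card_le_log)
  refine ⟨T, hTD, hTc, fun ψ hψ => ?_⟩
  by_contra! hT
  refine hψ (hD ψ fun d hd => ?_)
  obtain ⟨ε, hε, rfl⟩ := Finset.mem_addSpan.1 (hDT hd)
  have hr : (0 : ℝ) < 4 * ((Nat.log 2 (Fintype.card A) : ℝ) + 1) := by positivity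
  calc ‖ψ (∑ a ∈ T, ε a • a) - 1‖ ≤ ∑ a ∈ T, ‖ψ (ε a • a) - 1‖ :=
        ψ.norm_map_sum_sub_one_le _ _
    _ ≤ ∑ a ∈ T, ‖ψ a - 1‖ := by
        refine Finset.sum_le_sum fun a _ => ?_
        rw [AddChar.map_zsmul_eq_zpow]
        exact norm_zpow_sub_one_le (ψ.norm_apply a) (hε a)
    _ ≤ ∑ _a ∈ T, 1 / (4 * ((Nat.log 2 (Fintype.card A) : ℝ) + 1)) :=
        Finset.sum_le_sum fun a ha => (hT a ha).le
    _ = T.card * (1 / (4 * ((Nat.log 2 (Fintype.card A) : ℝ) + 1))) := by simp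
    _ < 1 / 4 := by
        rw [mul_one_div, div_lt_div_iff₀ hr (by norm_num)]
        have : (T.card : ℝ) ≤ Nat.log 2 (Fintype.card A) := by exact_mod_cast hTc
        linarith

theorem norm_one_add_le_of_le_norm_sub_one {z : ℂ} {δ : ℝ} (hz : ‖z‖ = 1) (hδ₀ : 0 ≤ δ)
    (hδ : δ ≤ ‖z - 1‖) : ‖1 + z‖ ≤ 2 - δ ^ 2 / 4 := by
  have h := parallelogram_law_with_norm ℝ (1 : ℂ) z
  rw [hz, norm_one, norm_sub_rev] at h
  have h2 : ‖z - 1‖ ≤ 2 := by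
    refine (norm_sub_le _ _).trans ?_
    rw [hz, norm_one]; norm_num
  refine abs_le_of_sq_le_sq' (a := ‖1 + z‖) ?_ (by nlinarith) |>.2
  nlinarith [sq_nonneg (δ ^ 2)]

/-- Fourier inversion on the `L`-fold sumset of `S`: if all nontrivial exponential sums over `S`
are small enough, every element is a sum of `L` elements of `S`. -/
theorem exists_sum_eq_of_charSum_le {A : Type*} [AddCommGroup A] [Fintype A] (S : Finset A)
    (L : ℕ) (b : ℝ) (hb₀ : 0 ≤ b)
    (hb : ∀ ψ : AddChar A ℂ, ψ ≠ 0 → ‖∑ s ∈ S, ψ s‖ ≤ b)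
    (hL : (Fintype.card A : ℝ) * b ^ L < (S.card : ℝ) ^ L) (a : A) :
    ∃ p : Fin L → A, (∀ i, p i ∈ S) ∧ ∑ i, p i = a := by
  classical
  by_contra! hp
  have h1 : ∑ ψ : AddChar A ℂ, (∑ s ∈ S, ψ s) ^ L * ψ (-a) = 0 := by
    calc ∑ ψ : AddChar A ℂ, (∑ s ∈ S, ψ s) ^ L * ψ (-a)
        = ∑ ψ : AddChar A ℂ, ∑ p ∈ Fintype.piFinset fun _ : Fin L => S,
            ψ (∑ i, p i + -a) := by
          refine Finset.sum_congr rfl fun ψ _ => ?_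
          rw [Finset.sum_pow', Finset.sum_mul]
          refine Finset.sum_congr rfl fun p _ => ?_
          rw [AddChar.map_add_eq_mul]
          congr 1
          exact (map_prod ψ.toMonoidHom (fun i => Multiplicative.ofAdd (p i)) _).symm
      _ = ∑ p ∈ Fintype.piFinset fun _ : Fin L => S, ∑ ψ : AddChar A ℂ,
            ψ (∑ i, p i + -a) := Finset.sum_comm
      _ = 0 := by
          refine Finset.sum_eq_zero fun p hpS => ?_
          rw [AddChar.sum_apply_eq_ite, if_neg]
          rw [← sub_eq_add_neg, sub_eq_zero]
          exact hp p (Fintype.mem_piFinset.1 hpS)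
  rw [← Finset.add_sum_erase _ _ (Finset.mem_univ (0 : AddChar A ℂ))] at h1
  have h2 : ‖∑ ψ ∈ Finset.univ.erase (0 : AddChar A ℂ), (∑ s ∈ S, ψ s) ^ L * ψ (-a)‖
      ≤ Fintype.card A * b ^ L := by
    calc _ ≤ ∑ ψ ∈ Finset.univ.erase (0 : AddChar A ℂ), ‖(∑ s ∈ S, ψ s) ^ L * ψ (-a)‖ :=
          norm_sum_le _ _
      _ ≤ ∑ ψ ∈ Finset.univ.erase (0 : AddChar A ℂ), b ^ L := by
          refine Finset.sum_le_sum fun ψ hψ => ?_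
          rw [norm_mul, AddChar.norm_apply, mul_one, norm_pow]
          exact pow_le_pow_left₀ (norm_nonneg _) (hb ψ (Finset.ne_of_mem_erase hψ)) _
      _ = ((Finset.univ.erase (0 : AddChar A ℂ)).card : ℝ) * b ^ L := by simp
      _ ≤ Fintype.card A * b ^ L := by
          refine mul_le_mul_of_nonneg_right ?_ (pow_nonneg hb₀ _)
          rw [← AddChar.card_eq (α := A)]
          exact_mod_cast Finset.card_le_univ _
  have h3 := eq_neg_of_add_eq_zero_left h1
  have h4 := congrArg (‖·‖) h3
  simp only [AddChar.zero_apply, Finset.sum_const, nsmul_eq_mul, mul_one, norm_neg, norm_pow,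
    Complex.norm_natCast] at h4
  linarith

/-- A set on which no nontrivial character is close to `1` generates a finite abelian group in
polylogarithmically many steps. -/
theorem exists_sum_eq_of_detecting {A : Type*} [AddCommGroup A] [Fintype A] (D : Finset A)
    (hD : ∀ ψ : AddChar A ℂ, (∀ d ∈ D, ‖ψ d - 1‖ < 1 / 4) → ψ = 0) :
    ∃ L : ℕ, (L : ℝ) ≤ 514 * (1 + Real.log (Fintype.card A)) ^ 4 ∧
      ∀ a : A, ∃ p : Fin L → A, (∀ i, p i = 0 ∨ p i ∈ D) ∧ ∑ i, p i = a := by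
  classical
  obtain ⟨T, hTD, hTc, hT⟩ := exists_small_subset_detecting D hD
  have hm : 1 ≤ Fintype.card A := Fintype.card_pos
  have hm' : (1 : ℝ) ≤ Fintype.card A := by exact_mod_cast hm
  set m : ℝ := (Fintype.card A : ℝ) with hm_def
  set l := Real.log m with hl
  have hl0 : 0 ≤ l := Real.log_nonneg hm'
  set r : ℝ := (Nat.log 2 (Fintype.card A) : ℝ) with hr
  have hr0 : 0 ≤ r := by positivity
  have hrl : r + 1 ≤ 2 * (1 + l) := by
    have h : (2 : ℝ) ^ Nat.log 2 (Fintype.card A) ≤ m := by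
      rw [hm_def]
      exact_mod_cast Nat.pow_log_le_self 2 (x := Fintype.card A) (by omega)
    have h' := Real.log_le_log (by positivity) h
    rw [Real.log_pow] at h'
    have := Real.log_two_gt_d9
    nlinarith
  set δ : ℝ := 1 / (4 * (r + 1)) with hδ
  have hδ0 : 0 < δ := by positivity
  have hδ1 : δ ≤ 1 := by
    rw [hδ, div_le_one (by positivity)]; linarith
  set S := insert 0 T with hS
  have hScard : (S.card : ℝ) ≤ r + 1 := by
    have := (Finset.card_insert_le 0 T).trans (Nat.add_le_add_right hTc 1)
    rw [hr]; exact_mod_cast this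
  have hS1 : (1 : ℝ) ≤ S.card := by
    exact_mod_cast Finset.card_pos.2 ⟨0, Finset.mem_insert_self _ _⟩
  have hb : ∀ ψ : AddChar A ℂ, ψ ≠ 0 → ‖∑ s ∈ S, ψ s‖ ≤ S.card - δ ^ 2 / 4 := by
    intro ψ hψ
    obtain ⟨t, htT, ht⟩ := hT ψ hψ
    have ht0 : t ≠ 0 := by
      rintro rfl
      rw [AddChar.map_zero_eq_one, sub_self, norm_zero] at ht
      linarith
    have htS : t ∈ S.erase 0 :=
      Finset.mem_erase.2 ⟨ht0, Finset.mem_insert_of_mem htT⟩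
    have h0S : (0 : A) ∈ S := Finset.mem_insert_self _ _
    rw [← Finset.add_sum_erase _ _ h0S, ← Finset.add_sum_erase _ _ htS, ← add_assoc,
      AddChar.map_zero_eq_one]
    refine (norm_add_le _ _).trans ?_
    have h1 := norm_one_add_le_of_le_norm_sub_one (ψ.norm_apply t) hδ0.le ht
    have h2 : ‖∑ s ∈ (S.erase 0).erase t, ψ s‖ ≤ (((S.erase 0).erase t).card : ℝ) := by
      refine (norm_sum_le _ _).trans ?_
      simp
    have h3 : (((S.erase 0).erase t).card : ℝ) + 2 = S.card := by
      have e1 := Finset.card_erase_add_one h0S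
      have e2 := Finset.card_erase_add_one htS
      exact_mod_cast (by omega : ((S.erase 0).erase t).card + 2 = S.card)
    linarith
  set L := ⌈512 * (1 + l) ^ 3 * l⌉₊ + 1 with hLdef
  have hL1 : 512 * (1 + l) ^ 3 * l < L := by
    rw [hLdef]; push_cast
    have := Nat.le_ceil (512 * (1 + l) ^ 3 * l)
    linarith
  refine ⟨L, ?_, fun a => ?_⟩
  · have h1 : (L : ℝ) ≤ 512 * (1 + l) ^ 3 * l + 2 := by
      rw [hLdef]; push_cast
      have := Nat.ceil_lt_add_one (a := 512 * (1 + l) ^ 3 * l) (by positivity)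
      linarith
    have h2 : (1 : ℝ) ≤ (1 + l) ^ 4 := one_le_pow₀ (by linarith)
    have h3 : 512 * (1 + l) ^ 3 * l ≤ 512 * (1 + l) ^ 4 := by
      have : 0 ≤ (1 + l) ^ 3 := by positivity
      nlinarith
    linarith
  · have hδS : 0 ≤ (S.card : ℝ) - δ ^ 2 / 4 := by nlinarith
    have hlt : m * ((S.card : ℝ) - δ ^ 2 / 4) ^ L < (S.card : ℝ) ^ L := by
      have hSpos : (0 : ℝ) < S.card := by linarith
      have h1 : (S.card : ℝ) - δ ^ 2 / 4 = S.card * (1 - δ ^ 2 / (4 * S.card)) := by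
        field_simp
      rw [h1, mul_pow, mul_left_comm]
      refine mul_lt_of_lt_one_right (by positivity) ?_
      set x := δ ^ 2 / (4 * S.card) with hx
      have hx1 : x ≤ 1 := by
        rw [hx, div_le_one (by positivity)]; nlinarith
      have hxl : l < x * L := by
        have h64 : 1 / (512 * (1 + l) ^ 3) ≤ x := by
          have h3 : (64 * (r + 1) ^ 3 : ℝ) ≤ 512 * (1 + l) ^ 3 := by
            have := pow_le_pow_left₀ (by positivity) hrl 3
            nlinarith
          calc 1 / (512 * (1 + l) ^ 3) ≤ 1 / (64 * (r + 1) ^ 3) :=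
                one_div_le_one_div_of_le (by positivity) h3
            _ = δ ^ 2 / (4 * (r + 1)) := by rw [hδ]; field_simp; norm_num
            _ ≤ x := by rw [hx]; gcongr
        calc l = 1 / (512 * (1 + l) ^ 3) * (512 * (1 + l) ^ 3 * l) := by field_simp
          _ < 1 / (512 * (1 + l) ^ 3) * L := by gcongr
          _ ≤ x * L := by gcongr
      calc m * (1 - x) ^ L ≤ m * Real.exp (-x) ^ L := by
            have h2 := Real.add_one_le_exp (-x)
            have h3 : (1 - x) ^ L ≤ Real.exp (-x) ^ L :=
              pow_le_pow_left₀ (by linarith) (by linarith) L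
            gcongr
        _ = Real.exp (l - x * L) := by
            rw [← Real.exp_nat_mul, Real.exp_sub, hl, Real.exp_log (by linarith),
              mul_neg, Real.exp_neg, mul_comm x]; rfl
        _ < 1 := Real.exp_lt_one_iff.2 (by linarith)
    obtain ⟨p, hp, hpa⟩ := exists_sum_eq_of_charSum_le S L _ hδS hb hlt a
    refine ⟨p, fun i => ?_, hpa⟩
    rcases Finset.mem_insert.1 (hp i) with h | h
    · exact Or.inl h
    · exact Or.inr (hTD h)

/-! ### Characters and displacement along closed arc walks -/

theorem abs_arg_lt_of_norm_sub_one_lt {z : ℂ} {c : ℝ} (hz : ‖z‖ = 1) (h : ‖z - 1‖ < c) :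
    |z.arg| < Real.pi / 2 * c := by
  have h0 : z ≠ 0 := by rintro rfl; simp at hz
  rw [← Complex.angle_one_left h0]
  refine (Complex.angle_le_mul_norm_sub (by simp) hz).trans_lt ?_
  rw [norm_sub_rev]
  have := Real.pi_pos
  gcongr

theorem norm_sq_sub_one_lt {z : ℂ} {c : ℝ} (hz : ‖z‖ = 1) (h : ‖z - 1‖ < c) :
    ‖z ^ 2 - 1‖ < 2 * c := by
  have : z ^ 2 - 1 = (z + 1) * (z - 1) := by ring
  rw [this, norm_mul]
  have h2 : ‖z + 1‖ ≤ 2 := by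
    refine (norm_add_le _ _).trans ?_
    rw [hz, norm_one]; norm_num
  nlinarith [norm_nonneg (z - 1)]

theorem arg_mul_mul_inv_of_abs_arg_lt {a b c : ℂ} (ha0 : a ≠ 0) (hb0 : b ≠ 0) (hc0 : c ≠ 0)
    (ha : |a.arg| < Real.pi / 4) (hb : |b.arg| < Real.pi / 4) (hc : |c.arg| < Real.pi / 4) :
    (a * b * c⁻¹).arg = a.arg + b.arg - c.arg := by
  rw [abs_lt] at ha hb hc
  have hpi := Real.pi_pos
  have hci : (c⁻¹).arg = -c.arg := by
    rw [Complex.arg_inv, if_neg (by intro h; linarith)]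
  have hab : (a * b).arg = a.arg + b.arg :=
    Complex.arg_mul ha0 hb0 ⟨by linarith, by linarith⟩
  rw [Complex.arg_mul (mul_ne_zero ha0 hb0) (inv_ne_zero hc0), hab, hci, ← sub_eq_add_neg]
  rw [hab, hci]
  exact ⟨by linarith, by linarith⟩

theorem eq_zero_of_forall_nat_mul_abs_le {d K : ℝ} (h : ∀ n : ℕ, |n * d| ≤ K) : d = 0 := by
  by_contra hd
  have hd' : 0 < |d| := abs_pos.2 hd
  obtain ⟨n, hn⟩ := exists_nat_gt (K / |d|)
  have h1 := h n
  rw [abs_mul, Nat.abs_cast] at h1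
  rw [div_lt_iff₀ hd'] at hn
  linarith

namespace SymDigraph

variable {V : Type*} {E : Type*} {G : SymDigraph V E}

theorem Connected.surjective_pred (hG : G.Connected) (e₀ : E) : Function.Surjective G.pred := by
  intro a
  rcases Relation.ReflTransGen.cases_head (hG a (G.pred e₀)) with h | ⟨_, ⟨e, he, _⟩, _⟩
  · exact ⟨e₀, h.symm⟩
  · exact ⟨e, he⟩

/-- In a connected graph, a property of arcs that spreads along `π`, where `π` sends every arc to an
arc leaving its head, and between arcs with the same tail, holds for all arcs. -/
theorem Connected.arc_induction (hG : G.Connected) {π : Equiv.Perm E}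
    (hπ : ∀ e, G.pred (π e) = G.succ e) {Q : E → Prop} {e₀ : E} (h₀ : Q e₀)
    (hnext : ∀ e, Q e → Q (π e)) (hadj : ∀ e e', G.pred e = G.pred e' → Q e → Q e') (e : E) :
    Q e := by
  have key : ∀ a, Relation.ReflTransGen (fun x y => ∃ e, G.pred e = x ∧ G.succ e = y)
      (G.pred e₀) a → ∀ e, G.pred e = a → Q e := by
    intro a ha
    induction ha with
    | refl => exact fun e he => hadj e₀ e he.symm h₀
    | tail _ hxy ih =>
      obtain ⟨e', he', he''⟩ := hxy
      intro e he
      exact hadj (π e') e (by rw [hπ, he'', he]) (hnext _ (ih e' he'))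
  exact key _ (hG _ _) e rfl

/-- Suppose that a permutation `π` sends every arc to an arc leaving its head, and that `X e` are
admissible integer positions of the arc `e`, where an arc moves by `1` along `π`. If a character
`ψ` is close to `1` on all differences of positions at a common vertex, then `ψ 1 ^ 2 = 1`.

Indeed `ψ ^ 2` of the position is almost a function `Θ` of the tail of the arc, and the argument
`ξ` of the quotient of the values of `Θ` at the ends of an arc changes sign under `opp`, so that its
sum over all arcs vanishes. On the other hand the sum of `ξ` along an orbit of `π` of length `n` is
`n` times the argument `τ` of `ψ 1 ^ 2`, up to a bounded error. Squaring `ψ` makes `τ` small: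
for an arc from `a` to `b`, going along the arc and back along the opposite one changes the position
by `2` plus a sum of two differences at `a` and `b`. -/
theorem sq_map_one_eq_one_of_close_on_positions [Fintype E] (hG : G.Connected) (e₀ : E)
    {π : Equiv.Perm E} (hπ : ∀ e, G.pred (π e) = G.succ e) {X : E → Set ℤ}
    (hX : ∀ e, (X e).Nonempty) (hXπ : ∀ e, ∀ x ∈ X e, x + 1 ∈ X (π e)) (n : ℕ) [NeZero n]
    (ψ : AddChar (ZMod n) ℂ)
    (hψ : ∀ e e', G.pred e = G.pred e' → ∀ x ∈ X e, ∀ x' ∈ X e',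
      ‖ψ ((x - x' : ℤ) : ZMod n) - 1‖ < 1 / 4) : ψ 1 ^ 2 = 1 := by
  classical
  choose p hp using hX
  have hsurj := hG.surjective_pred e₀
  set b : V → E := Function.surjInv hsurj with hb
  have hpb : ∀ v, G.pred (b v) = v := Function.surjInv_eq hsurj
  set φ : ℤ → ℂ := fun x => ψ (x : ZMod n) with hφ
  have hφn : ∀ x, ‖φ x‖ = 1 := fun x => ψ.norm_apply _
  have hφ0 : ∀ x, φ x ≠ 0 := fun x h => by
    have := hφn x; rw [h, norm_zero] at this; exact zero_ne_one this
  have hφadd : ∀ x y, φ (x + y) = φ x * φ y := fun x y => by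
    simp only [hφ, Int.cast_add, AddChar.map_add_eq_mul]
  have hφsub : ∀ x y, φ (x - y) = φ x / φ y := fun x y => by
    rw [eq_div_iff (hφ0 y), ← hφadd, sub_add_cancel]
  have hφ1 : φ 1 = ψ 1 := by simp [hφ]
  set Θ : V → ℂ := fun v => φ (p (b v)) ^ 2 with hΘ
  have hΘ0 : ∀ v, Θ v ≠ 0 := fun v => pow_ne_zero _ (hφ0 _)
  set o : E → ℤ → ℝ := fun e x => (φ x ^ 2 / Θ (G.pred e)).arg with ho
  have ho_lt : ∀ e, ∀ x ∈ X e, |o e x| < Real.pi / 4 := by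
    intro e x hx
    have h := hψ e (b (G.pred e)) (hpb _).symm x hx _ (hp _)
    have h1 := abs_arg_lt_of_norm_sub_one_lt (by rw [norm_pow]; simp [hφn])
      (norm_sq_sub_one_lt (hφn _) h)
    have h2 : φ x ^ 2 / Θ (G.pred e) = φ (x - p (b (G.pred e))) ^ 2 := by
      rw [hφsub, div_pow]
    rw [ho]; simp only; rw [h2]
    calc _ < _ := h1
      _ = Real.pi / 4 := by ring
  set τ : ℝ := (φ 1 ^ 2).arg with hτ
  have hτ_lt : |τ| < Real.pi / 4 := by
    have h1 := hψ (π e₀) (G.opp e₀) (by rw [hπ, G.pred_opp]) _ (hXπ _ _ (hp e₀)) _ (hp _)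
    have h2 := hψ (π (G.opp e₀)) e₀ (by rw [hπ, G.succ_opp]) _ (hXπ _ _ (hp _)) _ (hp e₀)
    change ‖φ _ - 1‖ < _ at h1 h2
    have h3 : φ 1 ^ 2 = φ (p e₀ + 1 - p (G.opp e₀)) * φ (p (G.opp e₀) + 1 - p e₀) := by
      rw [← hφadd, sq, ← hφadd]; congr 1; ring
    have h4 : ‖φ 1 ^ 2 - 1‖ < 1 / 2 := by
      rw [h3]
      set z := φ (p e₀ + 1 - p (G.opp e₀)) with hz
      set w := φ (p (G.opp e₀) + 1 - p e₀) with hw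
      have : z * w - 1 = z * (w - 1) + (z - 1) := by ring
      rw [this]
      refine (norm_add_le _ _).trans_lt ?_
      rw [norm_mul, hz, hφn, ← hz]
      linarith
    have h5 := abs_arg_lt_of_norm_sub_one_lt (by rw [norm_pow]; simp [hφn]) h4
    calc _ < _ := h5
      _ = Real.pi / 4 := by ring
  set ξ : E → ℝ := fun e => (Θ (G.succ e) / Θ (G.pred e)).arg with hξ
  have hξ_eq : ∀ e, ∀ x ∈ X e, ξ e = τ + o e x - o (π e) (x + 1) := by
    intro e x hx
    have h := arg_mul_mul_inv_of_abs_arg_lt (pow_ne_zero 2 (hφ0 1))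
      (div_ne_zero (pow_ne_zero 2 (hφ0 x)) (hΘ0 (G.pred e)))
      (div_ne_zero (pow_ne_zero 2 (hφ0 (x + 1))) (hΘ0 (G.pred (π e))))
      hτ_lt (ho_lt e x hx) (ho_lt _ _ (hXπ e x hx))
    rw [← h]
    simp only [hξ]
    congr 1
    rw [hπ, hφadd]
    have h1 := hφ0 x
    have h2 := hφ0 1
    have h3 := hΘ0 (G.succ e)
    have h4 := hΘ0 (G.pred e)
    field_simp
  have hξ_lt : ∀ e, |ξ e| < Real.pi := by
    intro e
    have h1 := abs_lt.1 (ho_lt e _ (hp e))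
    have h2 := abs_lt.1 (ho_lt _ _ (hXπ e _ (hp e)))
    have h3 := abs_lt.1 hτ_lt
    have := Real.pi_pos
    rw [hξ_eq e _ (hp e), abs_lt]
    constructor <;> linarith
  have hξ_opp : ∀ e, ξ (G.opp e) = -ξ e := by
    intro e
    have : Θ (G.succ (G.opp e)) / Θ (G.pred (G.opp e)) = (Θ (G.succ e) / Θ (G.pred e))⁻¹ := by
      rw [G.succ_opp, G.pred_opp, inv_div]
    simp only [hξ]
    rw [this, Complex.arg_inv, if_neg]
    exact (abs_lt.1 (hξ_lt e)).2.ne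
  have hξ_sum : ∑ e, ξ e = 0 := by
    have h : ∑ e, ξ (G.opp e) = ∑ e, ξ e :=
      Equiv.sum_comp (Function.Involutive.toPerm G.opp G.opp_opp) ξ
    simp only [hξ_opp, Finset.sum_neg_distrib] at h
    linarith
  have htel : ∀ e, ∀ x ∈ X e, ∀ N : ℕ, x + N ∈ X ((π ^ N) e) ∧
      ∑ j ∈ Finset.range N, ξ ((π ^ j) e) = N * τ + o e x - o ((π ^ N) e) (x + N) := by
    intro e x hx N
    induction N with
    | zero => simpa using hx
    | succ N ih =>
      have hs : (π ^ (N + 1)) e = π ((π ^ N) e) := by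
        rw [pow_succ', Equiv.Perm.mul_apply]
      have hx' : x + ((N + 1 : ℕ) : ℤ) = x + N + 1 := by push_cast; ring
      rw [hs, hx']
      refine ⟨hXπ _ _ ih.1, ?_⟩
      rw [Finset.sum_range_succ, ih.2, hξ_eq _ _ ih.1]
      push_cast; ring
  set P := orderOf π with hP
  have hP0 : 0 < P := orderOf_pos π
  have hper : ∀ e, ∀ N : ℕ, ∑ j ∈ Finset.range (N * P), ξ ((π ^ j) e)
      = N * ∑ j ∈ Finset.range P, ξ ((π ^ j) e) := by
    intro e N
    induction N with
    | zero => simp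
    | succ N ih =>
      rw [add_mul, one_mul, Finset.sum_range_add, ih]
      have : ∀ j, π ^ (N * P + j) = π ^ j := fun j => by
        rw [pow_add, mul_comm N P, pow_mul, hP, pow_orderOf_eq_one, one_pow, one_mul]
      simp only [this]
      push_cast; ring
  have horb : ∀ e, ∑ j ∈ Finset.range P, ξ ((π ^ j) e) = P * τ := by
    intro e
    rw [← sub_eq_zero]
    refine eq_zero_of_forall_nat_mul_abs_le (K := Real.pi) fun N => ?_
    have h1 := htel e _ (hp e) (N * P)
    have h2 := abs_lt.1 (ho_lt e _ (hp e))
    have h3 := abs_lt.1 (ho_lt _ _ h1.1)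
    have h4 := h1.2
    rw [hper] at h4
    have := Real.pi_pos
    have h5 : (N : ℝ) * (∑ j ∈ Finset.range P, ξ ((π ^ j) e) - P * τ)
        = o e (p e) - o ((π ^ (N * P)) e) (p e + ((N * P : ℕ) : ℤ)) := by
      rw [mul_sub, h4]; push_cast; ring
    rw [h5, abs_le]
    constructor <;> linarith
  have htot : (Fintype.card E : ℝ) * (P * τ) = 0 := by
    calc (Fintype.card E : ℝ) * (P * τ) = ∑ e, ∑ j ∈ Finset.range P, ξ ((π ^ j) e) := by
          simp [horb]
      _ = ∑ j ∈ Finset.range P, ∑ e, ξ ((π ^ j) e) := Finset.sum_comm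
      _ = 0 := by
          refine Finset.sum_eq_zero fun j _ => ?_
          rw [Equiv.sum_comp (π ^ j) ξ, hξ_sum]
  have hτ0 : τ = 0 := by
    have hE : (Fintype.card E : ℝ) ≠ 0 := by
      have : 0 < Fintype.card E := Fintype.card_pos_iff.2 ⟨e₀⟩
      positivity
    have hP' : (P : ℝ) ≠ 0 := by positivity
    simpa [hE, hP'] using htot
  rw [← hφ1]
  have h := Complex.norm_mul_exp_arg_mul_I (φ 1 ^ 2)
  rw [← hτ, hτ0, norm_pow, hφn] at h
  simpa using h.symm

/-- If a character is close to `1` on all differences of positions at a common vertex of a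
connected non-bipartite graph, then it is trivial: a character with value `-1` at `1` would give a
proper `2`-colouring of the vertices, by the parity of the positions. -/
theorem char_eq_zero_of_close_on_positions [Fintype E] (hG : G.Connected) (hbip : ¬ G.Bipartite)
    (e₀ : E) {π : Equiv.Perm E} (hπ : ∀ e, G.pred (π e) = G.succ e) {X : E → Set ℤ}
    (hX : ∀ e, (X e).Nonempty) (hXπ : ∀ e, ∀ x ∈ X e, x + 1 ∈ X (π e)) (n : ℕ) [NeZero n]
    (ψ : AddChar (ZMod n) ℂ)
    (hψ : ∀ e e', G.pred e = G.pred e' → ∀ x ∈ X e, ∀ x' ∈ X e',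
      ‖ψ ((x - x' : ℤ) : ZMod n) - 1‖ < 1 / 4) : ψ = 0 := by
  classical
  have hsq := sq_map_one_eq_one_of_close_on_positions hG e₀ hπ hX hXπ n ψ hψ
  have hpow : ∀ x : ℤ, ψ (x : ZMod n) = ψ 1 ^ x := fun x => by
    rw [← AddChar.map_zsmul_eq_zpow, zsmul_one]
  rcases mul_self_eq_one_iff.1 ((sq _).symm.trans hsq) with h1 | h1
  · ext a
    obtain ⟨x, rfl⟩ := ZMod.intCast_surjective a
    rw [hpow, h1, one_zpow, AddChar.zero_apply]
  · refine (hbip ?_).elim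
    have hpm : ∀ x : ℤ, ψ (x : ZMod n) = 1 ∨ ψ (x : ZMod n) = -1 := fun x => by
      rw [hpow, h1]
      exact (Int.even_or_odd x).imp Even.neg_one_zpow Odd.neg_one_zpow
    have hadj : ∀ e e', G.pred e = G.pred e' → ∀ x ∈ X e, ∀ x' ∈ X e',
        ψ (x : ZMod n) = ψ (x' : ZMod n) := by
      intro e e' he x hx x' hx'
      have h2 := hψ e e' he x hx x' hx'
      have h3 : ψ ((x - x' : ℤ) : ZMod n) = 1 := by
        rcases hpm (x - x') with h | h
        · exact h
        · rw [h] at h2; norm_num at h2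
      have : (x : ZMod n) = ((x - x' : ℤ) : ZMod n) + (x' : ZMod n) := by push_cast; ring
      rw [this, AddChar.map_add_eq_mul, h3, one_mul]
    choose p hp using hX
    have hsurj := hG.surjective_pred e₀
    have hpb : ∀ v, G.pred (Function.surjInv hsurj v) = v := Function.surjInv_eq hsurj
    refine ⟨fun v => decide (ψ (p (Function.surjInv hsurj v) : ZMod n) = 1), fun e => ?_⟩
    have h2 := hadj _ e (hpb (G.pred e)) _ (hp _) _ (hp e)
    have h3 := hadj _ (π e) ((hpb (G.succ e)).trans (hπ e).symm) _ (hp _) _ (hXπ e _ (hp e))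
    beta_reduce
    rw [h2, h3]
    push_cast
    rw [AddChar.map_add_eq_mul, h1]
    rcases hpm (p e) with h | h <;> rw [h] <;> norm_num
end SymDigraph

/-! ### Tokens circulating along a permutation of the arcs -/

/-- Tokens that move along a fixed permutation `next` of the arcs of `G`, which continues every arc
by an arc leaving its head. The number of tokens on the arc `e` at time `0` is `tokens e`, so at
time `t` it is `tokens (next ^ (-t) e)`. In all time windows, arcs with the same tail carry equal
numbers of tokens up to one. The window with parameters `T` and `t` consists of the times
`-t, -t + 1, …, -t + T - 1`. -/
structure ArcFlow {V E : Type*} (G : SymDigraph V E) where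
  next : Equiv.Perm E
  pred_next : ∀ e, G.pred (next e) = G.succ e
  tokens : E → ℕ
  balanced : ∀ (T : ℕ) (t : ℤ) (e e' : E), G.pred e = G.pred e' →
    |∑ i ∈ Finset.range T, (tokens ((next ^ (t - i)) e) : ℝ)
      - ∑ i ∈ Finset.range T, (tokens ((next ^ (t - i)) e') : ℝ)| ≤ 1

namespace ArcFlow

variable {V E : Type*} {G : SymDigraph V E} (F : ArcFlow G)

/-- The number of tokens on the arc `e` at the `T` consecutive times `-t, …, -t + T - 1`. -/
def window (T : ℕ) (t : ℤ) (e : E) : ℝ :=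
  ∑ i ∈ Finset.range T, (F.tokens ((F.next ^ (t - i)) e) : ℝ)

theorem abs_window_sub_window_le (T : ℕ) (t : ℤ) {e e' : E} (h : G.pred e = G.pred e') :
    |F.window T t e - F.window T t e'| ≤ 1 :=
  F.balanced T t e e' h

theorem window_zpow_apply (T : ℕ) (t s : ℤ) (e : E) :
    F.window T t ((F.next ^ s) e) = F.window T (t + s) e := by
  unfold window
  refine Finset.sum_congr rfl fun i _ => ?_
  rw [← Equiv.Perm.mul_apply, ← zpow_add]
  congr 4; ring

theorem window_next (T : ℕ) (t : ℤ) (e : E) :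
    F.window T t (F.next e) = F.window T (t + 1) e := by
  simpa using F.window_zpow_apply T t 1 e

theorem window_add (a b : ℕ) (t : ℤ) (e : E) :
    F.window (a + b) t e = F.window a t e + F.window b (t - a) e := by
  unfold window
  rw [Finset.sum_range_add]
  congr 1
  refine Finset.sum_congr rfl fun i _ => ?_
  congr 4; push_cast; ring

theorem sum_window [Fintype E] (T : ℕ) (t : ℤ) :
    ∑ e, F.window T t e = T * ∑ e, (F.tokens e : ℝ) := by
  unfold window
  rw [Finset.sum_comm]
  have h : ∀ i : ℕ, ∑ e, (F.tokens ((F.next ^ (t - i)) e) : ℝ) = ∑ e, (F.tokens e : ℝ) :=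
    fun i => Equiv.sum_comp (F.next ^ (t - i)) fun e => (F.tokens e : ℝ)
  rw [Finset.sum_congr rfl fun i _ => h i]
  simp

theorem window_sub_mul_orderOf (T n : ℕ) (t : ℤ) (e : E) :
    F.window T (t - (n * orderOf F.next : ℕ)) e = F.window T t e := by
  have h : F.next ^ (-((n * orderOf F.next : ℕ) : ℤ)) = 1 := by
    rw [zpow_neg, zpow_natCast, mul_comm, pow_mul, pow_orderOf_eq_one, one_pow, inv_one]
  rw [sub_eq_add_neg, ← window_zpow_apply, h, Equiv.Perm.one_apply]

theorem window_mul_orderOf (n : ℕ) (t : ℤ) (e : E) :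
    F.window (n * orderOf F.next) t e = n * F.window (orderOf F.next) t e := by
  induction n with
  | zero => simp [window]
  | succ n ih =>
    rw [add_mul, one_mul, window_add, ih, window_sub_mul_orderOf]
    push_cast; ring

theorem window_orderOf_eq_of_pred_eq (t : ℤ) {e e' : E} (h : G.pred e = G.pred e') :
    F.window (orderOf F.next) t e = F.window (orderOf F.next) t e' := by
  rw [← sub_eq_zero]
  refine eq_zero_of_forall_nat_mul_abs_le (K := 1) fun n => ?_
  rw [mul_sub, ← window_mul_orderOf, ← window_mul_orderOf]
  exact F.abs_window_sub_window_le _ _ h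

theorem window_orderOf_add_one (t : ℤ) (e : E) :
    F.window (orderOf F.next) (t + 1) e = F.window (orderOf F.next) t e := by
  have h1 := F.window_add 1 (orderOf F.next) (t + 1) e
  have h2 := F.window_add (orderOf F.next) 1 (t + 1) e
  have h3 := F.window_sub_mul_orderOf 1 1 (t + 1) e
  rw [one_mul] at h3
  rw [add_comm 1, h2, h3] at h1
  simp only [Nat.cast_one, add_sub_cancel_right] at h1
  linarith

/-- Over a full period, all arcs carry their fair share of the tokens. -/
theorem card_mul_window_orderOf [Fintype E] (hG : G.Connected) (t : ℤ) (e : E) :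
    Fintype.card E * F.window (orderOf F.next) t e
      = orderOf F.next * ∑ e, (F.tokens e : ℝ) := by
  rw [← F.sum_window _ t]
  have h : ∀ e', F.window (orderOf F.next) t e' = F.window (orderOf F.next) t e := by
    refine hG.arc_induction F.pred_next (e₀ := e) rfl ?_ ?_
    · intro e' h
      rw [window_next, window_orderOf_add_one, h]
    · intro e' e'' h h'
      rw [← F.window_orderOf_eq_of_pred_eq t h, h']
  simp [h]

/-- On a set of arcs that is invariant under `next`, the total number of tokens is an integer and
proportional to the size of the set, which is therefore not too small. -/
theorem card_le_card_mul_gcd [Fintype E] (hG : G.Connected) {O : Finset E} (hne : O.Nonempty)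
    (hO : ∀ e ∈ O, F.next e ∈ O) :
    Fintype.card E ≤ O.card * Nat.gcd (∑ e, F.tokens e) (Fintype.card E) := by
  classical
  set k := ∑ e, F.tokens e with hk
  set m := Fintype.card E with hm
  have hP : (orderOf F.next : ℝ) ≠ 0 := by
    have := orderOf_pos F.next
    positivity
  have himage : ∀ i : ℕ, O.image (F.next ^ i) = O := by
    intro i
    refine Finset.eq_of_subset_of_card_le ?_ ?_
    · intro x hx
      obtain ⟨e, he, rfl⟩ := Finset.mem_image.1 hx
      induction i with
      | zero => simpa using he
      | succ i ih =>
        rw [pow_succ', Equiv.Perm.mul_apply]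
        exact hO _ (ih (Finset.mem_image_of_mem _ he))
    · rw [Finset.card_image_of_injective _ (F.next ^ i).injective]
  have hsum : ∑ e ∈ O, F.window (orderOf F.next) 0 e
      = orderOf F.next * ∑ e ∈ O, (F.tokens e : ℝ) := by
    unfold window
    rw [Finset.sum_comm]
    have : ∀ i : ℕ, ∑ e ∈ O, (F.tokens ((F.next ^ (0 - (i : ℤ))) e) : ℝ)
        = ∑ e ∈ O, (F.tokens e : ℝ) := by
      intro i
      conv_lhs => rw [← himage i]
      rw [Finset.sum_image fun x _ y _ h => (F.next ^ i).injective h]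
      simp
    rw [Finset.sum_congr rfl fun i _ => this i]
    simp
  have h1 : (O.card * k : ℝ) = m * ∑ e ∈ O, (F.tokens e : ℝ) := by
    have h2 : ∑ e ∈ O, (m : ℝ) * F.window (orderOf F.next) 0 e
        = O.card * (orderOf F.next * k) := by
      simp [hm, F.card_mul_window_orderOf hG, hk]
    rw [← Finset.mul_sum, hsum] at h2
    refine mul_left_cancel₀ hP ?_
    linarith
  have h2 : O.card * k = m * ∑ e ∈ O, F.tokens e := by exact_mod_cast h1
  have hmpos : 0 < m := by
    obtain ⟨e, _⟩ := hne
    exact Fintype.card_pos_iff.2 ⟨e⟩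
  have h3 : m ∣ O.card * Nat.gcd k m := by
    rw [← Nat.gcd_mul_left]
    exact Nat.dvd_gcd ⟨_, h2⟩ (dvd_mul_left _ _)
  refine Nat.le_of_dvd ?_ h3
  exact Nat.mul_pos (Finset.card_pos.2 hne) (Nat.gcd_pos_of_pos_right _ hmpos)

/-- The arc `e` sees the same tokens as the arc `e₀` with a time shift `x`, up to `i` tokens in
every time window. -/
def Close (e₀ : E) (i : ℕ) (e : E) (x : ℤ) : Prop :=
  ∀ (T : ℕ) (t : ℤ), |F.window T t e - F.window T (t + x) e₀| ≤ i

variable {F}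

theorem Close.next {e₀ e : E} {i : ℕ} {x : ℤ} (h : F.Close e₀ i e x) :
    F.Close e₀ i (F.next e) (x + 1) := by
  intro T t
  rw [window_next, add_comm x, ← add_assoc]
  exact h T (t + 1)

theorem Close.of_pred_eq {e₀ e e' : E} {i : ℕ} {x : ℤ} (h : F.Close e₀ i e x)
    (he : G.pred e = G.pred e') : F.Close e₀ (i + 1) e' x := by
  intro T t
  have h1 := abs_le.1 (h T t)
  have h2 := abs_le.1 (F.abs_window_sub_window_le T t he)
  push_cast
  rw [abs_le]
  constructor <;> linarith [h1.1, h1.2, h2.1, h2.2]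

theorem Close.mono {e₀ e : E} {i j : ℕ} {x : ℤ} (h : F.Close e₀ i e x) (hij : i ≤ j) :
    F.Close e₀ j e x := fun T t => (h T t).trans (by exact_mod_cast hij)

theorem close_self (e₀ : E) : F.Close e₀ 0 e₀ 0 := fun T t => by simp

/-- Every arc is close to `e₀` with error `gcd k m`: allowing one more token either reaches all
arcs or at least one new orbit of `next`, and there are at most `gcd k m` orbits. -/
theorem exists_close [Fintype E] (hG : G.Connected) (e₀ e : E) :
    ∃ x, F.Close e₀ (Nat.gcd (∑ e, F.tokens e) (Fintype.card E)) e x := by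
  classical
  set g := Nat.gcd (∑ e, F.tokens e) (Fintype.card E) with hg
  set A : ℕ → Finset E := fun i => Finset.univ.filter fun e => ∃ x, F.Close e₀ i e x with hA
  have hmem : ∀ i e, e ∈ A i ↔ ∃ x, F.Close e₀ i e x := fun i e => by simp [hA]
  have hmono : ∀ i, A i ⊆ A (i + 1) := fun i e he => by
    obtain ⟨x, hx⟩ := (hmem _ _).1 he
    exact (hmem _ _).2 ⟨x, hx.mono (Nat.le_succ i)⟩
  have hnext : ∀ i e, e ∈ A i → F.next e ∈ A i := fun i e he => by
    obtain ⟨x, hx⟩ := (hmem _ _).1 he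
    exact (hmem _ _).2 ⟨x + 1, hx.next⟩
  have h0 : ∀ i, e₀ ∈ A i := fun i => (hmem _ _).2 ⟨0, close_self e₀ |>.mono (Nat.zero_le i)⟩
  have hm : 0 < Fintype.card E := Fintype.card_pos_iff.2 ⟨e₀⟩
  have hgrow : ∀ i, (∀ e, e ∈ A i) ∨ (i + 1) * Fintype.card E ≤ (A i).card * g := by
    intro i
    induction i with
    | zero =>
      right
      rw [zero_add, one_mul]
      exact F.card_le_card_mul_gcd hG ⟨e₀, h0 0⟩ (hnext 0)
    | succ i ih =>
      rcases ih with ih | ih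
      · exact Or.inl fun e => hmono i (ih e)
      · by_cases hall : ∀ e e', G.pred e = G.pred e' → e ∈ A i → e' ∈ A i
        · exact Or.inl fun e => hmono i
            (hG.arc_induction F.pred_next (Q := fun e => e ∈ A i) (h0 i) (hnext i) hall e)
        · right
          push Not at hall
          obtain ⟨e, e', hee', he, he'⟩ := hall
          obtain ⟨x, hx⟩ := (hmem _ _).1 he
          have hnew : e' ∈ A (i + 1) \ A i :=
            Finset.mem_sdiff.2 ⟨(hmem _ _).2 ⟨x, hx.of_pred_eq hee'⟩, he'⟩
          have himg : (A i).image F.next = A i := by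
            refine Finset.eq_of_subset_of_card_le ?_ ?_
            · intro y hy
              obtain ⟨z, hz, rfl⟩ := Finset.mem_image.1 hy
              exact hnext i z hz
            · rw [Finset.card_image_of_injective _ F.next.injective]
          have hcard := F.card_le_card_mul_gcd hG ⟨e', hnew⟩ (fun y hy => by
            obtain ⟨hy1, hy2⟩ := Finset.mem_sdiff.1 hy
            refine Finset.mem_sdiff.2 ⟨hnext _ y hy1, fun hy3 => hy2 ?_⟩
            rw [← himg] at hy3
            obtain ⟨z, hz, hzy⟩ := Finset.mem_image.1 hy3
            rwa [← F.next.injective hzy])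
          have hsplit := Finset.card_sdiff_add_card_eq_card (hmono i)
          rw [← hsplit, add_mul, add_mul, one_mul]
          linarith
  rcases hgrow g with h | h
  · exact (hmem _ _).1 (h e)
  · exfalso
    have h1 : (A g).card ≤ Fintype.card E := Finset.card_le_univ _
    have h2 : (A g).card * g ≤ Fintype.card E * g := Nat.mul_le_mul_right g h1
    nlinarith

theorem Close.abs_window_sub_le {e₀ e e' : E} {i : ℕ} {x x' : ℤ} (h : F.Close e₀ i e x)
    (h' : F.Close e₀ i e' x') (he : G.pred e = G.pred e') (T : ℕ) (t : ℤ) :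
    |F.window T t e₀ - F.window T (t + (x - x')) e₀| ≤ 2 * i + 1 := by
  have h1 := abs_le.1 (h T (t - x'))
  have h2 := abs_le.1 (h' T (t - x'))
  have h3 := abs_le.1 (F.abs_window_sub_window_le T (t - x') he)
  have e1 : t - x' + x = t + (x - x') := by ring
  rw [e1] at h1
  rw [sub_add_cancel] at h2
  rw [abs_le]
  constructor <;> linarith [h1.1, h1.2, h2.1, h2.2, h3.1, h3.2]

/-- A bound on the effect of all time shifts bounds the distance to the average. -/
theorem abs_window_sub_average_le [Fintype E] (hG : G.Connected) (e : E) {T : ℕ} {B : ℝ}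
    (hB : ∀ d : ℤ, |F.window T 0 e - F.window T d e| ≤ B) :
    |F.window T 0 e - T * ((∑ e, (F.tokens e : ℝ)) / Fintype.card E)| ≤ B := by
  set P := orderOf F.next with hP
  have hP0 : (0 : ℝ) < P := by exact_mod_cast orderOf_pos F.next
  have hm : (0 : ℝ) < Fintype.card E := by
    exact_mod_cast Fintype.card_pos_iff.2 ⟨e⟩
  have h1 : ∑ d ∈ Finset.range P, F.window T (-(d : ℤ)) e
      = P * (T * ((∑ e, (F.tokens e : ℝ)) / Fintype.card E)) := by
    calc ∑ d ∈ Finset.range P, F.window T (-(d : ℤ)) e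
        = ∑ i ∈ Finset.range T, F.window P (-(i : ℤ)) e := by
          unfold window
          rw [Finset.sum_comm]
          refine Finset.sum_congr rfl fun i _ => Finset.sum_congr rfl fun d _ => ?_
          congr 4; ring
      _ = ∑ i ∈ Finset.range T, P * ((∑ e, (F.tokens e : ℝ)) / Fintype.card E) := by
          refine Finset.sum_congr rfl fun i _ => ?_
          have := F.card_mul_window_orderOf hG (-(i : ℤ)) e
          rw [← mul_div_assoc, eq_div_iff hm.ne', mul_comm, this]
      _ = _ := by rw [Finset.sum_const, Finset.card_range, nsmul_eq_mul]; ring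
  have h2 : (P : ℝ) * (F.window T 0 e - T * ((∑ e, (F.tokens e : ℝ)) / Fintype.card E))
      = ∑ d ∈ Finset.range P, (F.window T 0 e - F.window T (-(d : ℤ)) e) := by
    rw [Finset.sum_sub_distrib, h1]; simp; ring
  have h3 : (P : ℝ) * |F.window T 0 e - T * ((∑ e, (F.tokens e : ℝ)) / Fintype.card E)|
      ≤ P * B := by
    calc _ = |∑ d ∈ Finset.range P, (F.window T 0 e - F.window T (-(d : ℤ)) e)| := by
          rw [← h2, abs_mul, abs_of_pos hP0]
      _ ≤ ∑ d ∈ Finset.range P, |F.window T 0 e - F.window T (-(d : ℤ)) e| :=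
          Finset.abs_sum_le_sum_abs _ _
      _ ≤ ∑ _d ∈ Finset.range P, B := Finset.sum_le_sum fun d _ => hB _
      _ = P * B := by simp
  exact le_of_mul_le_mul_left h3 hP0

/-- Time windows of a balanced circulation of `k` tokens on `m` arcs see the fair share of the
tokens, up to a polylogarithmic multiple of `gcd k m`. -/
theorem abs_window_sub_le [Fintype E] (hG : G.Connected) (hbip : ¬ G.Bipartite) (e₀ : E) (T : ℕ) :
    |F.window T 0 e₀ - T * ((∑ e, (F.tokens e : ℝ)) / Fintype.card E)| ≤
      1542 * (1 + Real.log (Fintype.card E)) ^ 4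
        * Nat.gcd (∑ e, F.tokens e) (Fintype.card E) := by
  classical
  set g := Nat.gcd (∑ e, F.tokens e) (Fintype.card E) with hg
  have hm : 0 < Fintype.card E := Fintype.card_pos_iff.2 ⟨e₀⟩
  have hg1 : (1 : ℝ) ≤ g := by exact_mod_cast Nat.gcd_pos_of_pos_right _ hm
  -- The load of `e₀` has the length `n ≤ m` of its orbit as a period, so shifts live in `ZMod n`.
  set n := Function.minimalPeriod F.next e₀ with hn
  have hn0 : 0 < n := Function.minimalPeriod_pos_of_mem_periodicPts
    (Function.Injective.mem_periodicPts F.next.injective e₀)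
  have : NeZero n := ⟨hn0.ne'⟩
  have hnm : n ≤ Fintype.card E := Function.minimalPeriod_le_card
  have hper : ∀ (t d : ℤ), F.window T (t + n * d) e₀ = F.window T t e₀ := by
    intro t d
    rw [← window_zpow_apply]
    congr 1
    rw [zpow_mul, zpow_natCast]
    refine Equiv.Perm.zpow_apply_eq_self_of_apply_eq_self ?_ d
    rw [← Equiv.Perm.iterate_eq_pow]
    exact Function.isPeriodicPt_minimalPeriod F.next e₀
  set D : Finset (ZMod n) := Finset.univ.filter fun a => ∃ (e e' : E) (x x' : ℤ),
    G.pred e = G.pred e' ∧ F.Close e₀ g e x ∧ F.Close e₀ g e' x' ∧ a = ((x - x' : ℤ) : ZMod n)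
    with hD
  obtain ⟨L, hL, hrep⟩ := exists_sum_eq_of_detecting D fun ψ hψ =>
    SymDigraph.char_eq_zero_of_close_on_positions hG hbip e₀ F.pred_next
      (X := fun e => {x | F.Close e₀ g e x}) (fun e => exists_close hG e₀ e)
      (fun e x hx => Close.next hx) n ψ fun e e' hee' x hx x' hx' =>
        hψ _ (Finset.mem_filter.2 ⟨Finset.mem_univ _, e, e', x, x', hee', hx, hx', rfl⟩)
  have hshift : ∀ a : ZMod n, a = 0 ∨ a ∈ D → ∃ d : ℤ, (d : ZMod n) = a ∧
      ∀ t, |F.window T t e₀ - F.window T (t + d) e₀| ≤ 2 * g + 1 := by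
    rintro a (rfl | ha)
    · refine ⟨0, by simp, fun t => ?_⟩
      rw [add_zero, sub_self, abs_zero]
      positivity
    · obtain ⟨e, e', x, x', hee', hx, hx', rfl⟩ := (Finset.mem_filter.1 ha).2
      exact ⟨x - x', rfl, hx.abs_window_sub_le hx' hee' T⟩
  refine (abs_window_sub_average_le hG e₀ (B := L * (2 * g + 1)) fun d => ?_).trans ?_
  · obtain ⟨p, hp, hpd⟩ := hrep (d : ZMod n)
    choose q hq hqb using fun i => hshift (p i) (hp i)
    have hind : ∀ s : Finset (Fin L),
        |F.window T 0 e₀ - F.window T (∑ i ∈ s, q i) e₀| ≤ s.card * (2 * g + 1) := by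
      intro s
      induction s using Finset.induction_on with
      | empty => simp
      | insert i s hi ih =>
        rw [Finset.sum_insert hi, Finset.card_insert_of_notMem hi, add_comm (q i)]
        have := abs_sub_le (F.window T 0 e₀) (F.window T (∑ i ∈ s, q i) e₀)
          (F.window T (∑ i ∈ s, q i + q i) e₀)
        have h2 := hqb i (∑ i ∈ s, q i)
        push_cast
        linarith
    have h1 := hind Finset.univ
    have h2 : ((∑ i, q i : ℤ) : ZMod n) = (d : ZMod n) := by
      rw [← hpd]; push_cast; simp [hq]
    obtain ⟨c, hc⟩ := (ZMod.intCast_eq_intCast_iff_dvd_sub _ _ _).1 h2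
    have h3 : d = ∑ i, q i + n * c := by linarith
    rw [h3, hper]
    simpa using h1
  · have hlog : Real.log (Fintype.card (ZMod n)) ≤ Real.log (Fintype.card E) := by
      rw [ZMod.card]
      exact Real.log_le_log (by exact_mod_cast hn0) (by exact_mod_cast hnm)
    have hlog0 : 0 ≤ Real.log (Fintype.card (ZMod n)) := Real.log_natCast_nonneg _
    have hL' : (L : ℝ) ≤ 514 * (1 + Real.log (Fintype.card E)) ^ 4 := by
      refine hL.trans ?_
      gcongr
    calc (L : ℝ) * (2 * g + 1) ≤ 514 * (1 + Real.log (Fintype.card E)) ^ 4 * (3 * g) := by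
          gcongr; linarith
      _ = _ := by ring

end ArcFlow

/-! ### Balanced families of sequences -/

theorem Monotone.eq_sum_add_div_of_le_add_one {n : ℕ} {a : Fin n → ℕ} (ha : Monotone a)
    (h : ∀ i j, a i ≤ a j + 1) (j : Fin n) : a j = (∑ i, a i + j) / n := by
  have hn : 0 < n := j.pos
  have hlo : n * a j ≤ ∑ i, a i + j := by
    calc n * a j = ∑ _i : Fin n, a j := by simp
      _ ≤ ∑ i, (a i + if i < j then 1 else 0) := by
          refine Finset.sum_le_sum fun i _ => ?_
          split_ifs with hij
          · exact h j i
          · exact ha (not_lt.1 hij)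
      _ = _ := by
          have hf : Finset.univ.filter (fun i => i < j) = Finset.Iio j := by ext; simp
          rw [Finset.sum_add_distrib, Finset.sum_boole, hf, Fin.card_Iio]
          simp
  have hhi : ∑ i, a i + j < n * a j + n := by
    have : ∑ i, a i ≤ n * a j + (n - 1 - j) := by
      calc ∑ i, a i ≤ ∑ i, (a j + if j < i then 1 else 0) := by
            refine Finset.sum_le_sum fun i _ => ?_
            split_ifs with hij
            · exact h i j
            · exact ha (not_lt.1 hij)
        _ = _ := by
          have hf : Finset.univ.filter (fun i => j < i) = Finset.Ioi j := by ext; simp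
          rw [Finset.sum_add_distrib, Finset.sum_boole, hf, Fin.card_Ioi]
          simp
    have := j.isLt
    omega
  symm
  rw [Nat.div_eq_iff hn, mul_comm (a j)]
  omega

/-- A family of sequences is balanced if any two of them have, over any time window, the same sum
up to one. -/
def BalancedFamily {ι : Type*} (α : ι → ℕ → ℕ) : Prop :=
  ∀ i i' t T, ∑ s ∈ Finset.range T, α i (t + s) ≤ ∑ s ∈ Finset.range T, α i' (t + s) + 1

/-- The partial sums of two sequences in a balanced family do not cross. -/
theorem BalancedFamily.sum_range_le_of_lt {ι : Type*} {α : ι → ℕ → ℕ} (hα : BalancedFamily α)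
    {i i' : ι} {T₀ : ℕ} (h : ∑ s ∈ Finset.range T₀, α i s < ∑ s ∈ Finset.range T₀, α i' s)
    (T : ℕ) : ∑ s ∈ Finset.range T, α i s ≤ ∑ s ∈ Finset.range T, α i' s := by
  rcases le_total T₀ T with hT | hT
  · obtain ⟨d, rfl⟩ := Nat.exists_eq_add_of_le hT
    have := hα i i' T₀ d
    rw [Finset.sum_range_add, Finset.sum_range_add]
    omega
  · obtain ⟨d, rfl⟩ := Nat.exists_eq_add_of_le hT
    have := hα i' i T d
    rw [Finset.sum_range_add, Finset.sum_range_add] at h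
    omega

/-- The members of a balanced family can be enumerated in such a way that the partial sums are a
function of the total partial sums and the index. -/
theorem BalancedFamily.exists_equiv {ι : Type*} [Fintype ι] {α : ι → ℕ → ℕ}
    (hα : BalancedFamily α) (P : ℕ) :
    ∃ σ : Fin (Fintype.card ι) ≃ ι, ∀ T ≤ P, ∀ j,
      ∑ s ∈ Finset.range T, α (σ j) s
        = (∑ s ∈ Finset.range T, ∑ i, α i s + j) / Fintype.card ι := by
  classical
  set ε : Fin (Fintype.card ι) ≃ ι := (Fintype.equivFin ι).symm
  set A : ι → ℕ → ℕ := fun i T => ∑ s ∈ Finset.range T, α i s with hA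
  -- Partial sums do not cross, so sorting by their sum over `T ≤ P` sorts them for each `T ≤ P`.
  set K : Fin (Fintype.card ι) → ℕ := fun j => ∑ T ∈ Finset.range (P + 1), A (ε j) T with hK
  refine ⟨(Tuple.sort K).trans ε, fun T hT j => ?_⟩
  have hmono : Monotone fun j => A (((Tuple.sort K).trans ε) j) T := by
    intro j j' hjj'
    have h1 : K (Tuple.sort K j) ≤ K (Tuple.sort K j') := Tuple.monotone_sort K hjj'
    by_contra! hlt
    simp only [Equiv.trans_apply] at hlt
    refine h1.not_gt ?_
    simp only [hK]
    exact Finset.sum_lt_sum (fun T' _ => hα.sum_range_le_of_lt hlt T')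
      ⟨T, Finset.mem_range.2 (by omega), hlt⟩
  have hle : ∀ i i', A i T ≤ A i' T + 1 := fun i i' => by simpa [hA] using hα i i' 0 T
  have h := hmono.eq_sum_add_div_of_le_add_one (fun j j' => hle _ _) j
  rw [Equiv.sum_comp ((Tuple.sort K).trans ε) fun i => A i T] at h
  rw [Finset.sum_comm]
  exact h

/-- Two balanced families with the same number of members and the same totals agree up to the
order of their members. -/
theorem BalancedFamily.exists_equiv_eq {ι κ : Type*} [Fintype ι] [Fintype κ] {α : ι → ℕ → ℕ}
    {β : κ → ℕ → ℕ} (hα : BalancedFamily α) (hβ : BalancedFamily β)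
    (hcard : Fintype.card ι = Fintype.card κ) (hsum : ∀ s, ∑ i, α i s = ∑ k, β k s) (P : ℕ) :
    ∃ σ : ι ≃ κ, ∀ i, ∀ s < P, β (σ i) s = α i s := by
  obtain ⟨σ, hσ⟩ := hα.exists_equiv P
  obtain ⟨σ', hσ'⟩ := hβ.exists_equiv P
  refine ⟨(σ.symm.trans (finCongr hcard)).trans σ', fun i s hs => ?_⟩
  have key : ∀ T ≤ P, ∑ s ∈ Finset.range T, β (σ' (finCongr hcard (σ.symm i))) s
      = ∑ s ∈ Finset.range T, α i s := by
    intro T hT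
    have h1 := hσ T hT (σ.symm i)
    rw [Equiv.apply_symm_apply] at h1
    rw [hσ' T hT, h1]
    simp [hsum, hcard]
  have h1 := key (s + 1) hs
  rw [Finset.sum_range_succ, Finset.sum_range_succ, key s hs.le] at h1
  simpa using h1

/-! ### Recurrent states of the rotor-router -/

theorem SymDigraph.sum_comp_succ {V E M : Type*} [Fintype E] [AddCommMonoid M]
    (G : SymDigraph V E) (h : V → M) : ∑ e, h (G.succ e) = ∑ e, h (G.pred e) := by
  have hs : ∑ e, h (G.pred (G.opp e)) = ∑ e, h (G.pred e) :=
    Equiv.sum_comp (Function.Involutive.toPerm G.opp G.opp_opp) fun e => h (G.pred e)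
  rw [← hs]
  exact Finset.sum_congr rfl fun e _ => by rw [G.pred_opp]

theorem SymDigraph.card_succ_eq_card_pred {V E : Type*} [DecidableEq V] [Fintype E]
    (G : SymDigraph V E) (a : V) :
    Fintype.card {e // G.succ e = a} = Fintype.card {e // G.pred e = a} := by
  refine Fintype.card_congr ((Function.Involutive.toPerm G.opp G.opp_opp).subtypeEquiv ?_)
  intro e
  change _ ↔ G.pred (G.opp e) = a
  rw [G.pred_opp]

/-- The identity behind the monotonicity of the sum of the squares of the loads: `y` is the vector
of loads of a later window, so that at each vertex its values on the leaving arcs are `q` and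
`q + 1` and have the same sum as the values of `x` on the entering arcs. -/
theorem SymDigraph.sum_sq_eq_add {V E : Type*} [Fintype V] [DecidableEq V] [Fintype E]
    (G : SymDigraph V E) {x y : E → ℤ} {q : V → ℤ}
    (hy : ∀ e, y e = q (G.pred e) ∨ y e = q (G.pred e) + 1)
    (hxy : ∀ a, ∑ e ∈ Finset.univ.filter (fun e => G.succ e = a), x e
      = ∑ e ∈ Finset.univ.filter (fun e => G.pred e = a), y e) :
    ∑ e, x e ^ 2 = ∑ e, y e ^ 2
      + ∑ e, (x e - q (G.succ e)) * (x e - q (G.succ e) - 1) := by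
  have h1 : ∑ e, (2 * q (G.succ e) + 1) * x e = ∑ e, (2 * q (G.pred e) + 1) * y e := by
    rw [← Finset.sum_fiberwise Finset.univ G.succ, ← Finset.sum_fiberwise Finset.univ G.pred]
    refine Finset.sum_congr rfl fun a _ => ?_
    have e1 : ∀ e ∈ Finset.univ.filter (fun e => G.succ e = a),
        (2 * q (G.succ e) + 1) * x e = (2 * q a + 1) * x e := fun e he => by
      rw [(Finset.mem_filter.1 he).2]
    have e2 : ∀ e ∈ Finset.univ.filter (fun e => G.pred e = a),
        (2 * q (G.pred e) + 1) * y e = (2 * q a + 1) * y e := fun e he => by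
      rw [(Finset.mem_filter.1 he).2]
    rw [Finset.sum_congr rfl e1, Finset.sum_congr rfl e2, ← Finset.mul_sum, ← Finset.mul_sum,
      hxy]
  have h2 : ∑ e, q (G.succ e) * (q (G.succ e) + 1) = ∑ e, q (G.pred e) * (q (G.pred e) + 1) :=
    G.sum_comp_succ fun a => q a * (q a + 1)
  have h3 : ∑ e, (x e - q (G.succ e)) * (x e - q (G.succ e) - 1)
      = ∑ e, x e ^ 2 - ∑ e, (2 * q (G.succ e) + 1) * x e
        + ∑ e, q (G.succ e) * (q (G.succ e) + 1) := by
    rw [← Finset.sum_sub_distrib, ← Finset.sum_add_distrib]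
    exact Finset.sum_congr rfl fun e _ => by ring
  have h4 : ∑ e, y e ^ 2 - ∑ e, (2 * q (G.pred e) + 1) * y e
        + ∑ e, q (G.pred e) * (q (G.pred e) + 1) = 0 := by
    rw [← Finset.sum_sub_distrib, ← Finset.sum_add_distrib]
    refine Finset.sum_eq_zero fun e _ => ?_
    rcases hy e with h | h <;> rw [h] <;> ring
  linarith

theorem Int.mul_sub_one_nonneg (n : ℤ) : 0 ≤ n * (n - 1) := by
  rcases le_or_gt n 0 with h | h
  · nlinarith
  · nlinarith [show (1 : ℤ) ≤ n from h]

namespace PortOrder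

section Load

variable {V E : Type*} [DecidableEq E] {G : SymDigraph V E} (ρ : PortOrder G)

theorem load_eq_count (x : RRState G) (e : E) :
    ρ.load x e = Nat.count (fun i => (ρ.next ^ i) (x.pointer (G.pred e)) = e)
      (x.tokens (G.pred e)) := by
  rw [Nat.count_eq_card_filter_range, load]

end Load

variable {V E : Type*} [DecidableEq V] [Fintype E] [DecidableEq E] {G : SymDigraph V E}
  (ρ : PortOrder G)

/-- The number of tokens sent along `e` in the first `n` moves out of its tail, if the pointer
is initially at `e₀`. -/
theorem count_next_pow_eq {e₀ e : E} (h : G.pred e₀ = G.pred e) (n : ℕ) :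
    Nat.count (fun i => (ρ.next ^ i) e₀ = e) n
        = n / (Finset.univ.filter fun e' => G.pred e' = G.pred e).card ∨
      Nat.count (fun i => (ρ.next ^ i) e₀ = e) n
        = n / (Finset.univ.filter fun e' => G.pred e' = G.pred e).card + 1 := by
  set s := Finset.univ.filter fun e' => G.pred e' = G.pred e with hs
  have hcyc : ρ.next.IsCycleOn (s : Set E) := by
    have := ρ.isCycleOn (G.pred e)
    simpa [hs] using this
  have he₀ : e₀ ∈ s := by simp [hs, h]
  have he : e ∈ s := by simp [hs]
  obtain ⟨v, _, hv⟩ := hcyc.exists_pow_eq he₀ he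
  have hpos : 0 < s.card := Finset.card_pos.2 ⟨e, he⟩
  have hcount : Nat.count (fun i => (ρ.next ^ i) e₀ = e) n
      = Nat.count (fun i => i ≡ v [MOD s.card]) n := by
    congr 1
    ext i
    rw [← hv]
    exact hcyc.pow_apply_eq_pow_apply he₀
  rw [hcount, Nat.count_modEq_card n hpos v]
  split_ifs
  · exact Or.inr rfl
  · exact Or.inl rfl

theorem sum_load_iterate (x : RRState G) (e : E) (T : ℕ) :
    ∑ s ∈ Finset.range T, ρ.load (ρ.step^[s] x) e
      = Nat.count (fun i => (ρ.next ^ i) (x.pointer (G.pred e)) = e)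
          (∑ s ∈ Finset.range T, (ρ.step^[s] x).tokens (G.pred e)) ∧
    (ρ.step^[T] x).pointer (G.pred e)
      = (ρ.next ^ (∑ s ∈ Finset.range T, (ρ.step^[s] x).tokens (G.pred e)))
          (x.pointer (G.pred e)) := by
  induction T with
  | zero => simp
  | succ T ih =>
    constructor
    · rw [Finset.sum_range_succ, Finset.sum_range_succ, ih.1, load_eq_count, ih.2, Nat.count_add]
      congr 2
      ext i
      rw [← Equiv.Perm.mul_apply, ← pow_add, add_comm i]
    · rw [Function.iterate_succ_apply', step]
      simp only
      rw [ih.2, Finset.sum_range_succ, ← Equiv.Perm.mul_apply, ← pow_add, add_comm]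

/-- In any time window, every arc leaving a vertex of degree `d` carries the share of the `N` tokens
sent out there: `N / d`, rounded down, or one more. -/
theorem sum_load_iterate_eq (x : RRState G) (e : E) (T : ℕ) :
    ∑ s ∈ Finset.range T, ρ.load (ρ.step^[s] x) e
        = (∑ s ∈ Finset.range T, (ρ.step^[s] x).tokens (G.pred e)) /
          (Finset.univ.filter fun e' => G.pred e' = G.pred e).card ∨
      ∑ s ∈ Finset.range T, ρ.load (ρ.step^[s] x) e
        = (∑ s ∈ Finset.range T, (ρ.step^[s] x).tokens (G.pred e)) /
          (Finset.univ.filter fun e' => G.pred e' = G.pred e).card + 1 := by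
  rw [(ρ.sum_load_iterate x e T).1]
  exact ρ.count_next_pow_eq (x.pred_pointer _) _

theorem sum_load_filter_pred (x : RRState G) (a : V) :
    ∑ e ∈ Finset.univ.filter (fun e => G.pred e = a), ρ.load x e = x.tokens a := by
  have h : ∀ e ∈ Finset.univ.filter (fun e => G.pred e = a), ρ.load x e
      = ((Finset.range (x.tokens a)).filter fun i => (ρ.next ^ i) (x.pointer a) = e).card := by
    intro e he
    rw [← (Finset.mem_filter.1 he).2, load]
  rw [Finset.sum_congr rfl h, ← Finset.card_eq_sum_card_fiberwise]
  · simp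
  · intro i _
    simp [ρ.pred_next_pow, x.pred_pointer]

theorem sum_load [Fintype V] (x : RRState G) : ∑ e, ρ.load x e = x.numTokens := by
  rw [RRState.numTokens, ← Finset.sum_fiberwise Finset.univ G.pred]
  exact Finset.sum_congr rfl fun a _ => ρ.sum_load_filter_pred x a

theorem numTokens_step [Fintype V] (x : RRState G) :
    (ρ.step x).numTokens = x.numTokens := by
  rw [← ρ.sum_load x, ← Finset.sum_fiberwise Finset.univ G.succ]
  rfl

theorem numTokens_stateAt [Fintype V] (x : RRState G) (t : ℕ) :
    (ρ.stateAt x t).numTokens = x.numTokens := by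
  induction t with
  | zero => rfl
  | succ t ih => rw [stateAt, Function.iterate_succ_apply', numTokens_step]; exact ih


/-- The token count of an arc over `T` steps, from step `t` on. -/
def loadSum (z : RRState G) (T t : ℕ) (e : E) : ℕ :=
  ∑ s ∈ Finset.range T, ρ.load (ρ.step^[t + s] z) e

theorem loadSum_eq_iterate (z : RRState G) (T t : ℕ) (e : E) :
    ρ.loadSum z T t e = ∑ s ∈ Finset.range T, ρ.load (ρ.step^[s] (ρ.step^[t] z)) e := by
  unfold loadSum
  exact Finset.sum_congr rfl fun s _ => by rw [add_comm, Function.iterate_add_apply]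

theorem sum_loadSum_filter_succ (z : RRState G) (T t : ℕ) (a : V) :
    ∑ e ∈ Finset.univ.filter (fun e => G.succ e = a), ρ.loadSum z T t e
      = ∑ e ∈ Finset.univ.filter (fun e => G.pred e = a), ρ.loadSum z T (t + 1) e := by
  unfold loadSum
  rw [Finset.sum_comm, Finset.sum_comm (s := Finset.univ.filter (fun e => G.pred e = a))]
  refine Finset.sum_congr rfl fun s _ => ?_
  rw [sum_load_filter_pred, show t + 1 + s = t + s + 1 by ring, Function.iterate_succ_apply']
  rfl

theorem loadSum_le_of_pred_eq (z : RRState G) (T t : ℕ) {e e' : E} (h : G.pred e = G.pred e') :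
    ρ.loadSum z T t e ≤ ρ.loadSum z T t e' + 1 := by
  rw [loadSum_eq_iterate, loadSum_eq_iterate]
  have h1 := ρ.sum_load_iterate_eq (ρ.step^[t] z) e T
  have h2 := ρ.sum_load_iterate_eq (ρ.step^[t] z) e' T
  rw [h] at h1
  omega

/-- The sum of the squares of the loads over a time window never increases with time, so it is
constant in a recurrent state, which forces all terms of the defect to vanish. Hence
the loads of the arcs entering a vertex are as balanced as those of the leaving arcs. -/
theorem loadSum_le_of_succ_eq [Fintype V] {z : RRState G} (hz : ρ.Recurrent z) (T t : ℕ) {e e' : E}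
    (h : G.succ e = G.succ e') : ρ.loadSum z T t e ≤ ρ.loadSum z T t e' + 1 := by
  obtain ⟨p, hp, hpz⟩ := hz
  set q : ℕ → V → ℤ := fun t a => (((∑ s ∈ Finset.range T, (ρ.step^[s] (ρ.step^[t] z)).tokens a) /
    (Finset.univ.filter fun e' => G.pred e' = a).card : ℕ) : ℤ) with hq
  set Φ : ℕ → ℤ := fun t => ∑ e, (ρ.loadSum z T t e : ℤ) ^ 2 with hΦ
  set D : ℕ → ℤ := fun t => ∑ e, ((ρ.loadSum z T t e : ℤ) - q (t + 1) (G.succ e)) *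
    ((ρ.loadSum z T t e : ℤ) - q (t + 1) (G.succ e) - 1) with hD
  have hstep : ∀ t, Φ t = Φ (t + 1) + D t := by
    intro t
    refine G.sum_sq_eq_add (fun e => ?_) fun a => ?_
    · have := ρ.sum_load_iterate_eq (ρ.step^[t + 1] z) e T
      rw [← loadSum_eq_iterate] at this
      rcases this with h | h
      · exact Or.inl (by rw [h])
      · exact Or.inr (by rw [h, Nat.cast_add, Nat.cast_one])
    · exact_mod_cast ρ.sum_loadSum_filter_succ z T t a
  have hD0 : ∀ t, 0 ≤ D t := fun t => Finset.sum_nonneg fun e _ => Int.mul_sub_one_nonneg _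
  have hanti : Antitone Φ := antitone_nat_of_succ_le fun t => by
    have := hstep t; have := hD0 t; linarith
  have hper : Φ (t + p) = Φ t := by
    simp only [hΦ, loadSum_eq_iterate, Function.iterate_add_apply, hpz]
  have hDt : D t = 0 := by
    have h1 := hanti (show t + 1 ≤ t + p by omega)
    have h2 := hstep t
    have h3 := hD0 t
    rw [hper] at h1
    linarith
  have hval : ∀ e, (ρ.loadSum z T t e : ℤ) = q (t + 1) (G.succ e) ∨
      (ρ.loadSum z T t e : ℤ) = q (t + 1) (G.succ e) + 1 := by
    intro e
    have h1 := (Finset.sum_eq_zero_iff_of_nonneg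
      fun e _ => Int.mul_sub_one_nonneg _).1 hDt e (Finset.mem_univ e)
    rcases mul_eq_zero.1 h1 with h2 | h2
    · exact Or.inl (by linarith)
    · exact Or.inr (by linarith)
  have h1 := hval e
  have h2 := hval e'
  rw [h] at h1
  omega

/-- In a recurrent state the tokens move along a permutation of the arcs: at every vertex, the
loads of the entering arcs and, one step later, of the leaving arcs are balanced families with the
same totals, so they agree up to a bijection. -/
theorem exists_perm_load [Fintype V] {z : RRState G} (hz : ρ.Recurrent z) :
    ∃ π : Equiv.Perm E, (∀ e, G.pred (π e) = G.succ e) ∧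
      ∀ t e, ρ.load (ρ.step^[t + 1] z) (π e) = ρ.load (ρ.step^[t] z) e := by
  obtain ⟨p, hp, hpz⟩ := id hz
  have hex : ∀ a : V, ∃ σ : {e // G.succ e = a} ≃ {e // G.pred e = a}, ∀ e, ∀ s < p,
      ρ.load (ρ.step^[s + 1] z) (σ e) = ρ.load (ρ.step^[s] z) e := by
    intro a
    refine BalancedFamily.exists_equiv_eq
      (α := fun (e : {e // G.succ e = a}) s => ρ.load (ρ.step^[s] z) e)
      (β := fun (e : {e // G.pred e = a}) s => ρ.load (ρ.step^[s + 1] z) e) ?_ ?_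
      (G.card_succ_eq_card_pred a) ?_ p
    · intro e e' t T
      exact ρ.loadSum_le_of_succ_eq hz T t (e.2.trans e'.2.symm)
    · intro e e' t T
      have := ρ.loadSum_le_of_pred_eq z T (t + 1) (e.2.trans e'.2.symm)
      simpa only [loadSum, add_right_comm t 1] using this
    · intro s
      have := ρ.sum_loadSum_filter_succ z 1 s a
      simp only [loadSum, Finset.sum_range_one, add_zero] at this
      rw [← Finset.sum_subtype_eq_sum_filter, ← Finset.sum_subtype_eq_sum_filter] at this
      simpa using this
  choose σ hσ using hex
  refine ⟨((Equiv.sigmaFiberEquiv G.succ).symm.trans (Equiv.sigmaCongrRight σ)).trans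
    (Equiv.sigmaFiberEquiv G.pred), fun e => (σ (G.succ e) ⟨e, rfl⟩).2, fun t e => ?_⟩
  have hmod : ∀ t, ρ.step^[t % p] z = ρ.step^[t] z :=
    Function.Periodic.map_mod_nat (f := fun t => ρ.step^[t] z) fun t => by
      beta_reduce
      rw [Function.iterate_add_apply, hpz]
  have hmod' : ρ.step^[t % p + 1] z = ρ.step^[t + 1] z := by
    rw [Function.iterate_succ_apply', hmod, Function.iterate_succ_apply']
  have h1 := hσ (G.succ e) ⟨e, rfl⟩ (t % p) (Nat.mod_lt _ hp)
  rw [hmod', hmod] at h1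
  exact h1

/-- The circulation of tokens along a permutation of the arcs that starts in a recurrent state. -/
theorem exists_arcFlow [Fintype V] {z : RRState G} (hz : ρ.Recurrent z) :
    ∃ F : ArcFlow G, (∀ e, F.tokens e = ρ.load z e) ∧
      ∀ T e, F.window T 0 e = ∑ s ∈ Finset.range T, (ρ.load (ρ.step^[s] z) e : ℝ) := by
  obtain ⟨π, hπ, hload⟩ := ρ.exists_perm_load hz
  have hpow : ∀ (t : ℕ) e, ρ.load z ((π ^ (-(t : ℤ))) e) = ρ.load (ρ.step^[t] z) e := by
    intro t
    induction t with
    | zero => simp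
    | succ t ih =>
      intro e
      have h1 := hload t (π⁻¹ e)
      rw [← Equiv.Perm.mul_apply, mul_inv_cancel, Equiv.Perm.one_apply] at h1
      rw [h1, ← ih, ← Equiv.Perm.mul_apply, ← zpow_sub_one]
      congr 3; push_cast; ring
  -- As `π` has finite order, a window at any integer time is one at a natural number.
  have hwin : ∀ t : ℤ, ∃ n : ℕ, ∀ (T : ℕ) e,
      ∑ i ∈ Finset.range T, (ρ.load z ((π ^ (t - i)) e) : ℝ) = ρ.loadSum z T n e := by
    intro t
    have hP : (0 : ℤ) < orderOf π := by exact_mod_cast orderOf_pos π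
    obtain ⟨n, hn⟩ := Int.eq_ofNat_of_zero_le (Int.emod_nonneg (-t) hP.ne')
    refine ⟨n, fun T e => ?_⟩
    unfold loadSum
    rw [Nat.cast_sum]
    refine Finset.sum_congr rfl fun i _ => ?_
    have hπn : π ^ (t - i) = π ^ (-((n + i : ℕ) : ℤ)) := by
      have h1 : π ^ (n : ℤ) = π ^ (-t) := by rw [← hn, zpow_mod_orderOf]
      rw [Nat.cast_add, neg_add, zpow_add, zpow_neg, h1, zpow_neg, inv_inv, ← zpow_add,
        sub_eq_add_neg]
    rw [hπn, hpow]
  refine ⟨⟨π, hπ, ρ.load z, fun T t e e' h => ?_⟩, fun _ => rfl, fun T e => ?_⟩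
  · obtain ⟨n, hn⟩ := hwin t
    rw [hn, hn, abs_le]
    have h1 : (ρ.loadSum z T n e : ℝ) ≤ ρ.loadSum z T n e' + 1 := by
      exact_mod_cast ρ.loadSum_le_of_pred_eq z T n h
    have h2 : (ρ.loadSum z T n e' : ℝ) ≤ ρ.loadSum z T n e + 1 := by
      exact_mod_cast ρ.loadSum_le_of_pred_eq z T n h.symm
    constructor <;> linarith
  · simp only [ArcFlow.window, zero_sub, hpow]

/-- From a recurrent state on, the average load of an arc is the fair share of the tokens, up to a
polylogarithmic multiple of `gcd k m / T`. -/
theorem abs_avgLoad_sub_le [Fintype V] (hG : G.Connected) (hbip : ¬ G.Bipartite) (x₀ : RRState G)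
    {t₀ T : ℕ} (hrec : ρ.Recurrent (ρ.stateAt x₀ t₀)) (hT : 1 ≤ T) (e : E) :
    |ρ.avgLoad x₀ t₀ T e - (x₀.numTokens : ℝ) / (Fintype.card E : ℝ)| ≤
      1542 * (1 + Real.log (Fintype.card E)) ^ 4
        * ((Nat.gcd x₀.numTokens (Fintype.card E) : ℝ) / T) := by
  obtain ⟨F, hFtok, hFwin⟩ := ρ.exists_arcFlow hrec
  have hk : ∑ e, F.tokens e = x₀.numTokens := by
    simp only [hFtok, sum_load, numTokens_stateAt]
  have h := F.abs_window_sub_le hG hbip e T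
  rw [← Nat.cast_sum, hk, hFwin] at h
  have hT0 : (0 : ℝ) < T := by exact_mod_cast hT
  have havg : ρ.avgLoad x₀ t₀ T e
      = (∑ s ∈ Finset.range T, (ρ.load (ρ.step^[s] (ρ.stateAt x₀ t₀)) e : ℝ)) / T := by
    unfold avgLoad
    rw [Finset.sum_Ico_eq_sum_range, Nat.add_sub_cancel_left]
    congr 1
    refine Finset.sum_congr rfl fun s _ => ?_
    rw [stateAt, stateAt, add_comm, Function.iterate_add_apply]
  have hdiv : ρ.avgLoad x₀ t₀ T e - (x₀.numTokens : ℝ) / (Fintype.card E : ℝ)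
      = (∑ s ∈ Finset.range T, (ρ.load (ρ.step^[s] (ρ.stateAt x₀ t₀)) e : ℝ)
        - T * ((x₀.numTokens : ℝ) / (Fintype.card E : ℝ))) / T := by
    rw [havg]; field_simp
  rw [hdiv, abs_div, abs_of_pos hT0, ← mul_div_assoc (1542 * _)]
  exact div_le_div_of_nonneg_right h hT0.le

end PortOrder

theorem theorem1 :
    (∃ (C : ℝ) (c : ℕ), 0 < C ∧
      ∀ (V : Type u) (E : Type v) [Fintype V] [DecidableEq V] [Fintype E] [DecidableEq E]
        (G : SymDigraph V E) (ρ : PortOrder G) (k m : ℕ) (x₀ : RRState G) (t₀ T : ℕ) (e : E),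
        G.Connected → ¬ G.Bipartite → m = Fintype.card E → x₀.numTokens = k →
        ρ.Recurrent (ρ.stateAt x₀ t₀) → 1 ≤ T →
        |ρ.avgLoad x₀ t₀ T e - (k : ℝ) / (m : ℝ)| ≤
          C * (1 + Real.log (m : ℝ)) ^ c * ((Nat.gcd k m : ℝ) / (T : ℝ))) ∧
    (∀ (C₀ : ℝ) (c₀ : ℕ), 0 < C₀ → ∃ (C : ℝ) (c : ℕ), 0 < C ∧
      ∀ (V : Type u) (E : Type v) [Fintype V] [DecidableEq V] [Fintype E] [DecidableEq E]
        (G : SymDigraph V E) (ρ : PortOrder G) (k m : ℕ) (x₀ : RRState G) (t₀ T : ℕ) (e : E),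
        G.Connected → ¬ G.Bipartite → m = Fintype.card E → x₀.numTokens = k →
        ρ.Recurrent (ρ.stateAt x₀ t₀) → 1 ≤ T →
        (Nat.gcd k m : ℝ) ≤ C₀ * (1 + Real.log (m : ℝ)) ^ c₀ →
        |ρ.avgLoad x₀ t₀ T e - (k : ℝ) / (m : ℝ)| ≤
          C * (1 + Real.log (m : ℝ)) ^ c / (T : ℝ)) := by
  refine ⟨⟨1542, 4, by norm_num, ?_⟩, fun C₀ c₀ hC₀ => ⟨1542 * C₀, 4 + c₀, by positivity, ?_⟩⟩
  · rintro V E _ _ _ _ G ρ k m x₀ t₀ T e hG hbip rfl rfl hrec hT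
    exact ρ.abs_avgLoad_sub_le hG hbip x₀ hrec hT e
  · rintro V E _ _ _ _ G ρ k m x₀ t₀ T e hG hbip rfl rfl hrec hT hgcd
    refine (ρ.abs_avgLoad_sub_le hG hbip x₀ hrec hT e).trans ?_
    have hlog : 0 ≤ Real.log (Fintype.card E) := Real.log_natCast_nonneg _
    rw [← mul_div_assoc]
    refine div_le_div_of_nonneg_right ?_ (Nat.cast_nonneg T)
    calc 1542 * (1 + Real.log (Fintype.card E)) ^ 4
          * (Nat.gcd x₀.numTokens (Fintype.card E) : ℝ)
        ≤ 1542 * (1 + Real.log (Fintype.card E)) ^ 4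
          * (C₀ * (1 + Real.log (Fintype.card E)) ^ c₀) := by gcongr
      _ = _ := by rw [pow_add]; ring
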